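/- Let $n\ge 1$ be an integer, write points of $\mathbb R^{2n}=\mathbb R^n\times\mathbb R^n$ as $z=(x,y)$ and set $z^*:=(-y,x)$. Let $\Omega\subset\mathbb R^{2n}$ be a bounded open set with Lipschitz boundary, and for $w\in W^{1,1}(\Omega)$ let $$\mathscr A(w):=\int_\Omega |\nabla w(z)+2z^*|\,dz .$$ Let $p\in[1,2]$ and $p':=\frac{p}{p-1}\in[2,+\infty]$ (with $p'=+\infty$ if $p=1$), and let $\varphi\in W^{1,p'}(\Omega)$. Consider the minimization problem $$\min\{\mathscr A(w): w\in\varphi+W^{1,p}_0(\Omega)\},$$ where $W^{1,p}_0(\Omega)$ is the closure of $C_c^\infty(\Omega)$ in $W^{1,p}(\Omega)$. If $u\in W^{1,p'}(\Omega)$ and $v\in W^{1,p}(\Omega)$ are both minimizers of this problem, then $u=v$ almost everywhere in $\Omega$ with respect to the Lebesgue measure. -/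

import Mathlib

open MeasureTheory Filter Topology
open scoped ENNReal NNReal ContDiff

/-- The space `ℝ²ⁿ = ℝⁿ × ℝⁿ`, with points `z = (x, y)`, coordinates `x i = z (Sum.inl i)` and
`y i = z (Sum.inr i)`, and the Euclidean norm. -/
abbrev HorizSpace (n : ℕ) : Type := EuclideanSpace ℝ (Fin n ⊕ Fin n)

/-- The map `z = (x, y) ↦ z* = (-y, x)`. -/
def hStar {n : ℕ} (z : HorizSpace n) : HorizSpace n :=
  WithLp.toLp 2 (Sum.elim (fun i => -z (Sum.inr i)) (fun i => z (Sum.inl i)))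

/-- `Ω` has Lipschitz boundary: around each boundary point, and in suitable orthonormal coordinates
with vertical direction `e`, `Ω` is the set of the points that lie strictly above the graph of a
Lipschitz function of the horizontal component `y - ⟪e, y⟫ e`. -/
def HasLipschitzBoundary {n : ℕ} (Ω : Set (HorizSpace n)) : Prop :=
  ∀ x ∈ frontier Ω, ∃ (r : ℝ) (e : HorizSpace n) (K : ℝ≥0) (g : HorizSpace n → ℝ),
    0 < r ∧ ‖e‖ = 1 ∧ LipschitzWith K g ∧
      ∀ y ∈ Metric.ball x r, (y ∈ Ω ↔ g (y - inner ℝ e y • e) < inner ℝ e y)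

/-- `ψ ∈ C_c^∞(Ω)`. -/
def IsTestFunction {n : ℕ} (Ω : Set (HorizSpace n)) (ψ : HorizSpace n → ℝ) : Prop :=
  ContDiff ℝ ∞ ψ ∧ HasCompactSupport ψ ∧ tsupport ψ ⊆ Ω

/-- `G` is a weak (distributional) gradient of `u` in the open set `Ω`. -/
def HasWeakGradient {n : ℕ} (Ω : Set (HorizSpace n)) (u : HorizSpace n → ℝ)
    (G : HorizSpace n → HorizSpace n) : Prop :=
  LocallyIntegrableOn u Ω volume ∧ LocallyIntegrableOn G Ω volume ∧
    ∀ ψ : HorizSpace n → ℝ, IsTestFunction Ω ψ → ∀ i : Fin n ⊕ Fin n,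
      ∫ z in Ω, u z * fderiv ℝ ψ z (EuclideanSpace.single i 1) = -∫ z in Ω, G z i * ψ z

open Classical in
/-- The weak gradient `∇u` of `u` in `Ω` (unique up to null sets in `Ω`, for `Ω` open);
by convention it is `0` if `u` has no weak gradient in `Ω`. -/
noncomputable def weakGradient {n : ℕ} (Ω : Set (HorizSpace n)) (u : HorizSpace n → ℝ) :
    HorizSpace n → HorizSpace n :=
  if h : ∃ G : HorizSpace n → HorizSpace n, HasWeakGradient Ω u G then h.choose else 0

/-- `u ∈ W^{1,p}(Ω)`. Elements are represented by functions on the whole space, whose values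
outside `Ω` play no role. -/
def MemSobolev {n : ℕ} (Ω : Set (HorizSpace n)) (p : ℝ≥0∞) (u : HorizSpace n → ℝ) : Prop :=
  MemLp u p (volume.restrict Ω) ∧
    ∃ G : HorizSpace n → HorizSpace n, HasWeakGradient Ω u G ∧ MemLp G p (volume.restrict Ω)

/-- `u ∈ W₀^{1,p}(Ω)`: the closure of `C_c^∞(Ω)` in `W^{1,p}(Ω)`. -/
def MemSobolevZero {n : ℕ} (Ω : Set (HorizSpace n)) (p : ℝ≥0∞) (u : HorizSpace n → ℝ) : Prop :=
  MemSobolev Ω p u ∧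
    ∃ ψ : ℕ → HorizSpace n → ℝ, (∀ k, IsTestFunction Ω (ψ k)) ∧
      Tendsto (fun k => eLpNorm (fun z => u z - ψ k z) p (volume.restrict Ω)) atTop (𝓝 0) ∧
      Tendsto (fun k => eLpNorm (fun z => weakGradient Ω u z - gradient (ψ k) z) p
        (volume.restrict Ω)) atTop (𝓝 0)

/-- The area functional `𝒜(u) = ∫_Ω |∇u + X*| dz`, with `X*(z) = 2 z*`, for `u ∈ W^{1,1}(Ω)`. -/
noncomputable def areaFunctional {n : ℕ} (Ω : Set (HorizSpace n)) (u : HorizSpace n → ℝ) : ℝ :=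
  ∫ z in Ω, ‖weakGradient Ω u z + (2 : ℝ) • hStar z‖

/-- `u` is a minimizer of `𝒜` over the affine class `φ + W₀^{1,p}(Ω)`. -/
def IsAreaMinimizer {n : ℕ} (Ω : Set (HorizSpace n)) (p : ℝ≥0∞) (φ u : HorizSpace n → ℝ) : Prop :=
  MemSobolevZero Ω p (fun z => u z - φ z) ∧
    ∀ w : HorizSpace n → ℝ, MemSobolevZero Ω p (fun z => w z - φ z) →
      areaFunctional Ω u ≤ areaFunctional Ω w

/-!
Let `X*(z) = 2z*`. The midpoint of two minimizers is again a competitor, so the convexity of the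
norm forces `|∇u + X* + ∇v + X*| = |∇u + X*| + |∇v + X*|` almost everywhere; by strict convexity
`∇u + X*` and `∇v + X*` lie on a common ray (`IsAreaMinimizer.sameRay`). The rotation `z ↦ z*` is
skew, so this says that `w = u - v` satisfies `F · ∇w = 0` with `F = 2z - (∇u)*`
(`inner_sub_eq_zero_of_sameRay`).

The rotated gradient `(∇u)*` is divergence free because second derivatives commute, whence
`div F = 4n` in the sense of distributions (`HasWeakGradient.setIntegral_inner_eq`), a nonzero
constant. Formally `div (h(w) F) = h'(w) ∇w · F + 4n h(w) = 4n h(w)`, and integrating over `Ω` with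
`w` vanishing on the boundary gives `∫ h(w) = 0` for every smooth Lipschitz `h` with `h(0) = 0`; a
nonnegative `h` with its only zero at `0` forces `w = 0`. To make this rigorous without a chain rule
for weak gradients, `w` is approximated by test functions `ψₖ`, and the distributional identity is
applied to the test functions `h(ψₖ)`. The limit uses Hölder's inequality, with `F ∈ L^{p'}` and
`∇ψₖ → ∇w` in `L^p` (`MemSobolevZero.ae_eq_zero_of_inner_eq_zero`).
-/

section

variable {n : ℕ} {Ω : Set (HorizSpace n)} {p : ℝ≥0∞}

/-! ### Calculus of weak gradients -/

theorem MeasureTheory.LocallyIntegrableOn.apply_euclidean {G : HorizSpace n → HorizSpace n}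
    (hG : LocallyIntegrableOn G Ω volume) (i : Fin n ⊕ Fin n) :
    LocallyIntegrableOn (fun z => G z i) Ω volume := by
  intro x hx
  obtain ⟨s, hs, h⟩ := hG x hx
  exact ⟨s, hs, (EuclideanSpace.proj (𝕜 := ℝ) i).integrable_comp h⟩

/-- A function locally integrable on `Ω` is integrable against continuous functions compactly
supported in `Ω`. -/
theorem MeasureTheory.LocallyIntegrableOn.integrableOn_mul {f g : HorizSpace n → ℝ}
    (hf : LocallyIntegrableOn f Ω volume) (hg : Continuous g) (hgc : HasCompactSupport g)
    (hgs : tsupport g ⊆ Ω) : IntegrableOn (fun z => f z * g z) Ω volume := by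
  have h1 : IntegrableOn (fun z => f z * g z) (tsupport g) volume :=
    (hf.integrableOn_compact_subset hgs hgc).mul_continuousOn hg.continuousOn hgc
  have h2 : Integrable (fun z => f z * g z) volume := by
    rw [← integrableOn_iff_integrable_of_support_subset (s := tsupport g)]
    · exact h1
    · intro z hz
      apply subset_tsupport
      intro h0
      apply hz
      change f z * g z = 0
      rw [h0, mul_zero]
  exact h2.integrableOn

namespace IsTestFunction

variable {ψ χ : HorizSpace n → ℝ}

theorem differentiable (h : IsTestFunction Ω ψ) : Differentiable ℝ ψ :=
  h.1.differentiable (by simp)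

theorem fderiv_apply (h : IsTestFunction Ω ψ) (e : HorizSpace n) :
    IsTestFunction Ω (fun z => fderiv ℝ ψ z e) :=
  ⟨(h.1.fderiv_right (m := ∞) (by simp)).clm_apply contDiff_const, h.2.1.fderiv_apply ℝ e,
    (tsupport_fderiv_apply_subset ℝ e).trans h.2.2⟩

theorem linear_comb (hψ : IsTestFunction Ω ψ) (hχ : IsTestFunction Ω χ) (a b : ℝ) :
    IsTestFunction Ω (fun z => a * ψ z + b * χ z) := by
  refine ⟨(contDiff_const.mul hψ.1).add (contDiff_const.mul hχ.1),
    (hψ.2.1.mul_left (f := fun _ => a)).add (hχ.2.1.mul_left (f := fun _ => b)), ?_⟩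
  refine (tsupport_add (fun z => a * ψ z) (fun z => b * χ z)).trans (Set.union_subset ?_ ?_)
  · exact (tsupport_mul_subset_right (f := fun _ => a)).trans hψ.2.2
  · exact (tsupport_mul_subset_right (f := fun _ => b)).trans hχ.2.2

theorem comp_left (hψ : IsTestFunction Ω ψ) {h : ℝ → ℝ} (hh : ContDiff ℝ ∞ h) (h0 : h 0 = 0) :
    IsTestFunction Ω (fun z => h (ψ z)) := by
  refine ⟨hh.comp hψ.1, hψ.2.1.comp_left h0, ?_⟩
  refine (closure_mono ?_).trans hψ.2.2
  exact Function.support_comp_subset h0 ψ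

theorem gradient_linear_comb (hψ : IsTestFunction Ω ψ) (hχ : IsTestFunction Ω χ) (a b : ℝ)
    (z : HorizSpace n) :
    gradient (fun z => a * ψ z + b * χ z) z = a • gradient ψ z + b • gradient χ z := by
  have h1 := ((hψ.differentiable z).const_mul a).hasFDerivAt.add
    ((hχ.differentiable z).const_mul b).hasFDerivAt
  unfold gradient
  erw [h1.fderiv]
  rw [fderiv_const_mul (hψ.differentiable z), fderiv_const_mul (hχ.differentiable z)]
  simp

theorem continuous_gradient (hψ : IsTestFunction Ω ψ) : Continuous (gradient ψ) :=
  (InnerProductSpace.toDual ℝ (HorizSpace n)).symm.continuous.comp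
    (hψ.1.continuous_fderiv (by simp))

theorem memLp_gradient (hψ : IsTestFunction Ω ψ) : MemLp (gradient ψ) p (volume.restrict Ω) := by
  refine (hψ.continuous_gradient.memLp_of_hasCompactSupport ?_).restrict _
  exact (hψ.2.1.fderiv ℝ).comp_left (g := (InnerProductSpace.toDual ℝ (HorizSpace n)).symm)
    (map_zero _)

theorem integrable (hψ : IsTestFunction Ω ψ) : Integrable ψ (volume.restrict Ω) :=
  (hψ.1.continuous.integrable_of_hasCompactSupport hψ.2.1).integrableOn

end IsTestFunction

namespace HasWeakGradient

variable {u v : HorizSpace n → ℝ} {G H : HorizSpace n → HorizSpace n}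

/-- The weak gradient is unique up to null sets. -/
theorem ae_eq (hΩ : IsOpen Ω) (hG : HasWeakGradient Ω u G) (hH : HasWeakGradient Ω u H) :
    G =ᵐ[volume.restrict Ω] H := by
  have key : ∀ i, ∀ᵐ z ∂volume, z ∈ Ω → G z i - H z i = 0 := by
    intro i
    have lG := hG.2.1.apply_euclidean i
    have lH := hH.2.1.apply_euclidean i
    refine hΩ.ae_eq_zero_of_integral_contDiff_smul_eq_zero (lG.sub lH) ?_
    intro g g1 g2 g3
    have e1 := hG.2.2 g ⟨g1, g2, g3⟩ i
    have e2 := hH.2.2 g ⟨g1, g2, g3⟩ i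
    have i1 := lG.integrableOn_mul g1.continuous g2 g3
    have i2 := lH.integrableOn_mul g1.continuous g2 g3
    rw [← setIntegral_eq_integral_of_forall_compl_eq_zero (s := Ω)]
    · have : ∀ z, g z • (G z i - H z i) = G z i * g z - H z i * g z := fun z => by
        rw [smul_eq_mul]; ring
      simp only [this]
      rw [integral_sub i1 i2]
      linarith
    · intro z hz
      rw [image_eq_zero_of_notMem_tsupport (fun h => hz (g3 h)), zero_smul]
  rw [Filter.EventuallyEq, ae_restrict_iff' hΩ.measurableSet]
  filter_upwards [ae_all_iff.2 key] with z hz hzΩ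
  ext i
  linarith [hz i hzΩ]

theorem linear_comb (hG : HasWeakGradient Ω u G) (hH : HasWeakGradient Ω v H) (a b : ℝ) :
    HasWeakGradient Ω (fun z => a * u z + b * v z) (fun z => a • G z + b • H z) := by
  refine ⟨(hG.1.smul a).add (hH.1.smul b), (hG.2.1.smul a).add (hH.2.1.smul b), ?_⟩
  intro ψ hψ i
  have hd := hψ.fderiv_apply (EuclideanSpace.single i 1)
  have i1 := hG.1.integrableOn_mul hd.1.continuous hd.2.1 hd.2.2
  have i2 := hH.1.integrableOn_mul hd.1.continuous hd.2.1 hd.2.2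
  have i3 := (hG.2.1.apply_euclidean i).integrableOn_mul hψ.1.continuous hψ.2.1 hψ.2.2
  have i4 := (hH.2.1.apply_euclidean i).integrableOn_mul hψ.1.continuous hψ.2.1 hψ.2.2
  have e1 := hG.2.2 ψ hψ i
  have e2 := hH.2.2 ψ hψ i
  simp only [PiLp.add_apply, PiLp.smul_apply, smul_eq_mul, add_mul, mul_assoc]
  rw [integral_add (i1.const_mul a) (i2.const_mul b), integral_add (i3.const_mul a) (i4.const_mul b)]
  simp only [integral_const_mul]
  rw [e1, e2]
  ring

theorem weakGradient (hG : HasWeakGradient Ω u G) : HasWeakGradient Ω u (weakGradient Ω u) := by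
  have h : ∃ G : HorizSpace n → HorizSpace n, HasWeakGradient Ω u G := ⟨G, hG⟩
  unfold _root_.weakGradient
  rw [dif_pos h]
  exact h.choose_spec

end HasWeakGradient

/-! ### Sobolev classes -/

namespace MemSobolev

variable {u v : HorizSpace n → ℝ}

theorem hasWeakGradient (hu : MemSobolev Ω p u) : HasWeakGradient Ω u (weakGradient Ω u) :=
  hu.2.choose_spec.1.weakGradient

theorem memLp_weakGradient (hΩ : IsOpen Ω) (hu : MemSobolev Ω p u) :
    MemLp (weakGradient Ω u) p (volume.restrict Ω) := by
  obtain ⟨-, G, hG, hGp⟩ := hu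
  exact hGp.ae_eq (hG.ae_eq hΩ hG.weakGradient)

theorem mono_exponent {q : ℝ≥0∞} (hΩ : Bornology.IsBounded Ω) (hpq : p ≤ q)
    (hu : MemSobolev Ω q u) : MemSobolev Ω p u := by
  have : IsFiniteMeasure (volume.restrict Ω) := ⟨by simpa using hΩ.measure_lt_top⟩
  obtain ⟨h, G, hG, hGq⟩ := hu
  exact ⟨h.mono_exponent hpq, G, hG, hGq.mono_exponent hpq⟩

theorem linear_comb (hu : MemSobolev Ω p u) (hv : MemSobolev Ω p v) (a b : ℝ) :
    MemSobolev Ω p (fun z => a * u z + b * v z) := by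
  obtain ⟨hu1, G, hG, hGp⟩ := hu
  obtain ⟨hv1, H, hH, hHp⟩ := hv
  exact ⟨(hu1.const_mul a).add (hv1.const_mul b), _, hG.linear_comb hH a b,
    (hGp.const_smul a).add (hHp.const_smul b)⟩

theorem weakGradient_linear_comb {q : ℝ≥0∞} (hΩ : IsOpen Ω) (hu : MemSobolev Ω p u)
    (hv : MemSobolev Ω q v) (a b : ℝ) :
    weakGradient Ω (fun z => a * u z + b * v z) =ᵐ[volume.restrict Ω]
      fun z => a • weakGradient Ω u z + b • weakGradient Ω v z :=
  have h := hu.hasWeakGradient.linear_comb hv.hasWeakGradient a b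
  h.weakGradient.ae_eq hΩ h

end MemSobolev

/-- A linear combination of two sequences tending to zero in `Lᵖ` tends to zero in `Lᵖ`. -/
theorem tendsto_eLpNorm_linear_comb {α E : Type*} [MeasurableSpace α] {μ : Measure α}
    [NormedAddCommGroup E] [NormedSpace ℝ E] (hp : 1 ≤ p) {f g : ℕ → α → E}
    (hf : ∀ k, AEStronglyMeasurable (f k) μ) (hg : ∀ k, AEStronglyMeasurable (g k) μ)
    (hf0 : Tendsto (fun k => eLpNorm (f k) p μ) atTop (𝓝 0))
    (hg0 : Tendsto (fun k => eLpNorm (g k) p μ) atTop (𝓝 0)) (a b : ℝ) :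
    Tendsto (fun k => eLpNorm (fun z => a • f k z + b • g k z) p μ) atTop (𝓝 0) := by
  have hlim : Tendsto (fun k => ‖a‖ₑ * eLpNorm (f k) p μ + ‖b‖ₑ * eLpNorm (g k) p μ) atTop
      (𝓝 0) := by
    have := (ENNReal.Tendsto.const_mul (a := ‖a‖ₑ) hf0 (Or.inr enorm_ne_top)).add
      (ENNReal.Tendsto.const_mul (a := ‖b‖ₑ) hg0 (Or.inr enorm_ne_top))
    simpa using this
  refine tendsto_of_tendsto_of_tendsto_of_le_of_le tendsto_const_nhds hlim (fun _ => zero_le) ?_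
  intro k
  refine (eLpNorm_add_le ((hf k).const_smul a) ((hg k).const_smul b) hp).trans ?_
  rw [eLpNorm_const_smul, eLpNorm_const_smul]

theorem MemSobolevZero.linear_comb {u v : HorizSpace n → ℝ} (hΩ : IsOpen Ω) (hp : 1 ≤ p)
    (hu : MemSobolevZero Ω p u) (hv : MemSobolevZero Ω p v) (a b : ℝ) :
    MemSobolevZero Ω p (fun z => a * u z + b * v z) := by
  obtain ⟨hu, ψ, hψ, hψ0, hψ1⟩ := hu
  obtain ⟨hv, χ, hχ, hχ0, hχ1⟩ := hv
  refine ⟨hu.linear_comb hv a b, fun k z => a * ψ k z + b * χ k z,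
    fun k => (hψ k).linear_comb (hχ k) a b, ?_, ?_⟩
  · refine (tendsto_eLpNorm_linear_comb hp
      (fun k => hu.1.1.sub (hψ k).1.continuous.aestronglyMeasurable)
      (fun k => hv.1.1.sub (hχ k).1.continuous.aestronglyMeasurable) hψ0 hχ0 a b).congr ?_
    intro k
    congr 1
    funext z
    simp only [smul_eq_mul, Pi.sub_apply]
    ring
  · refine (tendsto_eLpNorm_linear_comb hp
      (fun k => (hu.memLp_weakGradient hΩ).1.sub (hψ k).continuous_gradient.aestronglyMeasurable)
      (fun k => (hv.memLp_weakGradient hΩ).1.sub (hχ k).continuous_gradient.aestronglyMeasurable)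
      hψ1 hχ1 a b).congr ?_
    intro k
    refine eLpNorm_congr_ae ?_
    filter_upwards [hu.weakGradient_linear_comb hΩ hv a b] with z hz
    rw [hz, (hψ k).gradient_linear_comb (hχ k)]
    simp only [Pi.sub_apply]
    module

/-! ### The rotation `z ↦ z*` -/

theorem inner_sum_type (a b : HorizSpace n) :
    inner ℝ a b = ∑ i, (a (Sum.inl i) * b (Sum.inl i) + a (Sum.inr i) * b (Sum.inr i)) := by
  rw [PiLp.inner_apply, Fintype.sum_sum_type, ← Finset.sum_add_distrib]
  simp [mul_comm]

theorem inner_hStar_right (a b : HorizSpace n) :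
    inner ℝ a (hStar b) = ∑ i, (a (Sum.inr i) * b (Sum.inl i) - a (Sum.inl i) * b (Sum.inr i)) := by
  rw [inner_sum_type]
  refine Finset.sum_congr rfl fun i _ => ?_
  simp only [hStar, Sum.elim_inl, Sum.elim_inr]
  ring

theorem hStar_add (a b : HorizSpace n) : hStar (a + b) = hStar a + hStar b := by
  ext i
  cases i <;> simp [hStar]; ring

theorem hStar_smul (c : ℝ) (a : HorizSpace n) : hStar (c • a) = c • hStar a := by
  ext i
  cases i <;> simp [hStar]

theorem inner_hStar_left (a b : HorizSpace n) :
    inner ℝ (hStar a) b = -inner ℝ a (hStar b) := by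
  rw [real_inner_comm, inner_hStar_right, inner_hStar_right, ← Finset.sum_neg_distrib]
  exact Finset.sum_congr rfl fun i _ => by ring

theorem hStar_hStar (a : HorizSpace n) : hStar (hStar a) = -a := by
  ext i
  cases i <;> simp [hStar]

theorem inner_hStar_self (a : HorizSpace n) : inner ℝ a (hStar a) = 0 := by
  rw [inner_hStar_right]
  exact Finset.sum_eq_zero fun i _ => by ring

theorem norm_hStar (a : HorizSpace n) : ‖hStar a‖ = ‖a‖ := by
  rw [@norm_eq_sqrt_real_inner _ _ _ (hStar a), inner_hStar_left, hStar_hStar, inner_neg_right,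
    neg_neg, ← norm_eq_sqrt_real_inner]

theorem continuous_hStar : Continuous (hStar : HorizSpace n → HorizSpace n) :=
  LinearMap.continuous_of_finiteDimensional
    ({ toFun := hStar, map_add' := hStar_add, map_smul' := hStar_smul } :
      HorizSpace n →ₗ[ℝ] HorizSpace n)

/-- Vectors on a common ray are orthogonal up to the rotation; applied to `∇u + X*` and `∇v + X*`,
this says that `∇u - ∇v` is orthogonal to the field `2z - (∇u)*`. -/
theorem inner_sub_eq_zero_of_sameRay {z g h : HorizSpace n}
    (hr : SameRay ℝ (g + (2 : ℝ) • hStar z) (h + (2 : ℝ) • hStar z)) :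
    inner ℝ ((2 : ℝ) • z - hStar g) (g - h) = 0 := by
  have hab : inner ℝ (g + (2 : ℝ) • hStar z) (hStar (h + (2 : ℝ) • hStar z)) = 0 := by
    generalize g + (2 : ℝ) • hStar z = a at hr
    generalize h + (2 : ℝ) • hStar z = b at hr
    obtain rfl | rfl | ⟨r, s, hr0, hs0, h⟩ := hr
    · simp
    · simp [inner_hStar_right]
    · have h1 : a = (r⁻¹ * s) • b := by rw [mul_smul, ← h, inv_smul_smul₀ hr0.ne']
      rw [h1, real_inner_smul_left, inner_hStar_self, mul_zero]
  rw [hStar_add, hStar_smul, hStar_hStar] at hab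
  simp only [inner_add_left, inner_add_right, inner_sub_left, inner_sub_right,
    real_inner_smul_left, real_inner_smul_right, inner_neg_right, inner_hStar_left, hStar_hStar,
    neg_neg] at hab ⊢
  rw [inner_hStar_self z] at hab
  rw [inner_hStar_self g, real_inner_comm g z]
  linarith

/-! ### The divergence of `2z - (∇u)*` -/

theorem gradient_apply (η : HorizSpace n → ℝ) (z : HorizSpace n) (i : Fin n ⊕ Fin n) :
    gradient η z i = fderiv ℝ η z (EuclideanSpace.single i 1) := by
  rw [← inner_gradient_left, EuclideanSpace.inner_single_right]
  simp

namespace IsTestFunction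

variable {η : HorizSpace n → ℝ}

theorem gradient_apply_isTest (hη : IsTestFunction Ω η) (i : Fin n ⊕ Fin n) :
    IsTestFunction Ω (fun z => gradient η z i) := by
  simp only [gradient_apply]
  exact hη.fderiv_apply _

/-- Symmetry of second derivatives. -/
theorem fderiv_gradient_comm (hη : IsTestFunction Ω η) (z : HorizSpace n) (i j : Fin n ⊕ Fin n) :
    fderiv ℝ (fun z => gradient η z i) z (EuclideanSpace.single j 1) =
      fderiv ℝ (fun z => gradient η z j) z (EuclideanSpace.single i 1) := by
  have hd : DifferentiableAt ℝ (fderiv ℝ η) z :=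
    (hη.1.fderiv_right (m := 1) (by norm_cast)).differentiable (by simp) z
  have hs : IsSymmSndFDerivAt ℝ η z :=
    hη.1.contDiffAt.isSymmSndFDerivAt (by rw [minSmoothness_of_isRCLikeNormedField]; norm_cast)
  simp only [gradient_apply]
  rw [fderiv_clm_apply hd (differentiableAt_const _), fderiv_clm_apply hd (differentiableAt_const _)]
  simpa using hs _ _

/-- Integration by parts against a coordinate function, `∫ zᵢ ∂ᵢη = -∫ η`. -/
theorem setIntegral_coord_mul (hη : IsTestFunction Ω η) (i : Fin n ⊕ Fin n) :
    ∫ z in Ω, z i * gradient η z i = -∫ z in Ω, η z := by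
  have hc : Continuous fun z : HorizSpace n => z i :=
    (EuclideanSpace.proj (𝕜 := ℝ) i).continuous
  have hloc : LocallyIntegrableOn (fun z : HorizSpace n => z i) Set.univ volume :=
    (hc.locallyIntegrable).locallyIntegrableOn _
  have hg := hη.gradient_apply_isTest i
  have hf : ∀ z : HorizSpace n, fderiv ℝ (fun z : HorizSpace n => z i) z
      (EuclideanSpace.single i 1) = 1 := by
    intro z
    rw [show (fun z : HorizSpace n => z i) = EuclideanSpace.proj (𝕜 := ℝ) i from rfl,
      ContinuousLinearMap.fderiv]
    simp
  rw [setIntegral_eq_integral_of_forall_compl_eq_zero,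
    setIntegral_eq_integral_of_forall_compl_eq_zero]
  · simp only [gradient_apply]
    rw [integral_mul_fderiv_eq_neg_fderiv_mul_of_integrable (𝕜 := ℝ)]
    · simp [hf]
    · simp only [hf, one_mul]
      exact hη.1.continuous.integrable_of_hasCompactSupport hη.2.1
    · simp only [← gradient_apply]
      simpa using hloc.integrableOn_mul hg.1.continuous hg.2.1 (Set.subset_univ _)
    · simpa using hloc.integrableOn_mul hη.1.continuous hη.2.1 (Set.subset_univ _)
    · intro z _
      exact (EuclideanSpace.proj (𝕜 := ℝ) i).differentiableAt
    · intro z _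
      exact hη.differentiable z
  · intro z hz
    exact image_eq_zero_of_notMem_tsupport fun h => hz (hη.2.2 h)
  · intro z hz
    rw [image_eq_zero_of_notMem_tsupport (f := fun z => gradient η z i) fun h => hz (hg.2.2 h),
      mul_zero]

end IsTestFunction

/-- The rotated gradient `(∇u)*` is divergence free in the sense of distributions. -/
theorem HasWeakGradient.setIntegral_inner_hStar {u : HorizSpace n → ℝ}
    {G : HorizSpace n → HorizSpace n} (hG : HasWeakGradient Ω u G) {η : HorizSpace n → ℝ}
    (hη : IsTestFunction Ω η) : ∫ z in Ω, inner ℝ (hStar (G z)) (gradient η z) = 0 := by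
  have hi : ∀ i j, IntegrableOn (fun z => G z i * gradient η z j) Ω volume := fun i j =>
    (hG.2.1.apply_euclidean i).integrableOn_mul (hη.gradient_apply_isTest j).1.continuous
      (hη.gradient_apply_isTest j).2.1 (hη.gradient_apply_isTest j).2.2
  have hd : ∀ i : Fin n, Integrable (fun z => G z (Sum.inr i) * gradient η z (Sum.inl i) -
      G z (Sum.inl i) * gradient η z (Sum.inr i)) (volume.restrict Ω) := fun i =>
    (hi _ _).sub (hi _ _)
  simp only [inner_hStar_left, inner_hStar_right]
  rw [integral_neg, integral_finsetSum _ fun i _ => hd i, neg_eq_zero]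
  refine Finset.sum_eq_zero fun i _ => ?_
  rw [integral_sub (hi _ _) (hi _ _)]
  have e1 := hG.2.2 _ (hη.gradient_apply_isTest (Sum.inl i)) (Sum.inr i)
  have e2 := hG.2.2 _ (hη.gradient_apply_isTest (Sum.inr i)) (Sum.inl i)
  simp only [hη.fderiv_gradient_comm _ (Sum.inl i) (Sum.inr i)] at e1
  linarith

/-- In the sense of distributions, `div (2z - (∇u)*) = 4n`. -/
theorem HasWeakGradient.setIntegral_inner_eq {u : HorizSpace n → ℝ}
    {G : HorizSpace n → HorizSpace n} (hG : HasWeakGradient Ω u G) {η : HorizSpace n → ℝ}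
    (hη : IsTestFunction Ω η) :
    ∫ z in Ω, inner ℝ ((2 : ℝ) • z - hStar (G z)) (gradient η z) =
      -(4 * n * ∫ z in Ω, η z) := by
  have hloc : LocallyIntegrableOn (fun z : HorizSpace n => z) Ω volume :=
    continuous_id.locallyIntegrable.locallyIntegrableOn _
  have hi : ∀ i, IntegrableOn (fun z => z i * gradient η z i) Ω volume := fun i =>
    (hloc.apply_euclidean i).integrableOn_mul (hη.gradient_apply_isTest i).1.continuous
      (hη.gradient_apply_isTest i).2.1 (hη.gradient_apply_isTest i).2.2
  have hi' : ∀ i j, IntegrableOn (fun z => G z i * gradient η z j) Ω volume := fun i j =>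
    (hG.2.1.apply_euclidean i).integrableOn_mul (hη.gradient_apply_isTest j).1.continuous
      (hη.gradient_apply_isTest j).2.1 (hη.gradient_apply_isTest j).2.2
  have hs : ∀ i : Fin n, Integrable (fun z => z (Sum.inl i) * gradient η z (Sum.inl i) +
      z (Sum.inr i) * gradient η z (Sum.inr i)) (volume.restrict Ω) := fun i =>
    (hi _).add (hi _)
  have hd : ∀ i : Fin n, Integrable (fun z => G z (Sum.inr i) * gradient η z (Sum.inl i) -
      G z (Sum.inl i) * gradient η z (Sum.inr i)) (volume.restrict Ω) := fun i =>
    (hi' _ _).sub (hi' _ _)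
  have h1 : IntegrableOn (fun z => inner ℝ z (gradient η z)) Ω volume := by
    simp only [inner_sum_type]
    exact integrable_finsetSum _ fun i _ => hs i
  have h2 : IntegrableOn (fun z => inner ℝ (hStar (G z)) (gradient η z)) Ω volume := by
    simp only [inner_hStar_left, inner_hStar_right]
    exact (integrable_finsetSum _ fun i _ => hd i).neg
  simp only [inner_sub_left, real_inner_smul_left]
  rw [integral_sub (h1.const_mul 2) h2, hG.setIntegral_inner_hStar hη, integral_const_mul]
  simp only [inner_sum_type]
  rw [integral_finsetSum _ fun i _ => hs i]
  have : ∀ i : Fin n, ∫ z in Ω, (z (Sum.inl i) * gradient η z (Sum.inl i) +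
      z (Sum.inr i) * gradient η z (Sum.inr i)) = -(2 * ∫ z in Ω, η z) := by
    intro i
    rw [integral_add (hi _) (hi _), hη.setIntegral_coord_mul, hη.setIntegral_coord_mul]
    ring
  rw [Finset.sum_congr rfl fun i _ => this i]
  simp
  ring

/-! ### Fields of nonzero constant divergence -/

/-- The nonnegative smooth function `t ↦ √(1 + t²) - 1`, with bounded derivative and vanishing
only at `0`. -/
noncomputable def smoothAbs (t : ℝ) : ℝ := √(1 + t ^ 2) - 1

theorem one_add_sq_pos (t : ℝ) : 0 < 1 + t ^ 2 := by positivity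

theorem contDiff_smoothAbs : ContDiff ℝ ∞ smoothAbs :=
  ((contDiff_const.add (contDiff_id.pow 2)).sqrt fun t => (one_add_sq_pos t).ne').sub contDiff_const

theorem smoothAbs_zero : smoothAbs 0 = 0 := by simp [smoothAbs]

theorem smoothAbs_nonneg (t : ℝ) : 0 ≤ smoothAbs t := by
  have : (1 : ℝ) ≤ √(1 + t ^ 2) := Real.one_le_sqrt.2 (by nlinarith [sq_nonneg t])
  simpa [smoothAbs] using this

theorem eq_zero_of_smoothAbs_eq_zero {t : ℝ} (h : smoothAbs t = 0) : t = 0 := by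
  have h1 : √(1 + t ^ 2) = 1 := by unfold smoothAbs at h; linarith
  rw [Real.sqrt_eq_one] at h1
  simpa using h1

theorem abs_deriv_smoothAbs_le (t : ℝ) : |deriv smoothAbs t| ≤ 1 := by
  have hd : HasDerivAt smoothAbs (t / √(1 + t ^ 2)) t := by
    have h0 : HasDerivAt (fun t : ℝ => 1 + t ^ 2) (2 * t) t := by
      simpa using (hasDerivAt_pow 2 t).const_add 1
    have h1 : HasDerivAt smoothAbs (2 * t / (2 * √(1 + t ^ 2))) t :=
      (h0.sqrt (one_add_sq_pos t).ne').sub_const 1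
    rwa [mul_div_mul_left _ _ two_ne_zero] at h1
  rw [hd.deriv, abs_div, abs_of_nonneg (Real.sqrt_nonneg _)]
  refine div_le_one_of_le₀ (Real.abs_le_sqrt (by linarith)) (Real.sqrt_nonneg _)

theorem abs_smoothAbs_sub_le (s t : ℝ) : |smoothAbs s - smoothAbs t| ≤ |s - t| := by
  have := Convex.norm_image_sub_le_of_norm_deriv_le (f := smoothAbs) (s := Set.univ) (C := 1)
    (x := t) (y := s) (fun x _ => contDiff_smoothAbs.differentiable (by simp) x)
    (fun x _ => abs_deriv_smoothAbs_le x) convex_univ (Set.mem_univ _) (Set.mem_univ _)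
  simpa using this

theorem IsTestFunction.gradient_smoothAbs_comp {ψ : HorizSpace n → ℝ} (hψ : IsTestFunction Ω ψ)
    (z : HorizSpace n) :
    gradient (fun z => smoothAbs (ψ z)) z = deriv smoothAbs (ψ z) • gradient ψ z := by
  have h := (contDiff_smoothAbs.differentiable (by simp) (ψ z)).hasDerivAt.comp_hasFDerivAt z
    (hψ.differentiable z).hasFDerivAt
  unfold gradient
  erw [h.fderiv]
  simp

theorem eLpNorm_inner_le {α E : Type*} [MeasurableSpace α] {μ : Measure α}
    [NormedAddCommGroup E] [InnerProductSpace ℝ E] {q : ℝ≥0∞} [ENNReal.HolderConjugate q p]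
    {F G : α → E} (hF : AEStronglyMeasurable F μ) (hG : AEStronglyMeasurable G μ) :
    eLpNorm (fun z => inner ℝ (F z) (G z)) 1 μ ≤ eLpNorm F q μ * eLpNorm G p μ := by
  simpa using eLpNorm_le_eLpNorm_mul_eLpNorm'_of_norm (p := q) (q := p) (r := 1) hF hG
    (fun a b : E => inner ℝ a b) 1
    (Eventually.of_forall fun z => by simpa using abs_real_inner_le_norm (F z) (G z))

/-- If `F ∈ L^q` has distributional divergence a nonzero constant `c`, then the only
`w ∈ W₀^{1,p}` with `F · ∇w = 0` is `0`: testing the divergence with `h(ψₖ)`, where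
`h(t) = √(1 + t²) - 1` and `ψₖ → w`, yields `∫ h(w) = 0`. -/
theorem MemSobolevZero.ae_eq_zero_of_inner_eq_zero {q : ℝ≥0∞} [hpq : ENNReal.HolderConjugate q p]
    (hΩ : IsOpen Ω) (hΩb : Bornology.IsBounded Ω) {w : HorizSpace n → ℝ}
    (hw : MemSobolevZero Ω p w) {F : HorizSpace n → HorizSpace n}
    (hF : MemLp F q (volume.restrict Ω)) {c : ℝ} (hc : c ≠ 0)
    (hdiv : ∀ η, IsTestFunction Ω η →
      ∫ z in Ω, inner ℝ (F z) (gradient η z) = -(c * ∫ z in Ω, η z))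
    (horth : ∀ᵐ z ∂volume.restrict Ω, inner ℝ (F z) (weakGradient Ω w z) = 0) :
    ∀ᵐ z ∂volume.restrict Ω, w z = 0 := by
  have hfin : IsFiniteMeasure (volume.restrict Ω) := ⟨by simpa using hΩb.measure_lt_top⟩
  have hpq' : ENNReal.HolderConjugate p q := ENNReal.HolderTriple.symm
  have hp : 1 ≤ p := ENNReal.HolderConjugate.one_le p q
  obtain ⟨hwS, ψ, hψ, hψ0, hψ1⟩ := hw
  have hη : ∀ k, IsTestFunction Ω (fun z => smoothAbs (ψ k z)) := fun k =>
    (hψ k).comp_left contDiff_smoothAbs smoothAbs_zero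
  have hwint : Integrable w (volume.restrict Ω) := hwS.1.integrable hp
  -- The fluxes of the test fields tend to zero, by Hölder's inequality and `F · ∇w = 0`.
  have hflux : Tendsto (fun k => ∫ z in Ω, inner ℝ (F z) (gradient (fun z => smoothAbs (ψ k z)) z))
      atTop (𝓝 0) := by
    have hL1 := tendsto_integral_of_L1 (μ := volume.restrict Ω) (l := atTop) (fun _ => (0 : ℝ))
      aestronglyMeasurable_const
      (F := fun k z => inner ℝ (F z) (gradient (fun z => smoothAbs (ψ k z)) z)) ?_ ?_
    · simpa using hL1
    · refine Eventually.of_forall fun k => ?_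
      refine memLp_one_iff_integrable.1 ?_
      have hm := (hη k).memLp_gradient (p := p)
      refine ⟨hF.1.inner hm.1, ?_⟩
      exact (eLpNorm_inner_le hF.1 hm.1).trans_lt (ENNReal.mul_lt_top hF.2 hm.2)
    · have hlim : Tendsto (fun k => eLpNorm F q (volume.restrict Ω) * eLpNorm
          (fun z => weakGradient Ω w z - gradient (ψ k) z) p (volume.restrict Ω)) atTop (𝓝 0) := by
        simpa using ENNReal.Tendsto.const_mul hψ1 (Or.inr hF.2.ne)
      refine tendsto_of_tendsto_of_tendsto_of_le_of_le tendsto_const_nhds hlim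
        (fun _ => zero_le) fun k => ?_
      have hm : AEStronglyMeasurable (fun z => weakGradient Ω w z - gradient (ψ k) z)
          (volume.restrict Ω) := (hwS.memLp_weakGradient hΩ).1.sub
            (hψ k).continuous_gradient.aestronglyMeasurable
      refine le_trans ?_ (eLpNorm_inner_le hF.1 hm)
      rw [eLpNorm_one_eq_lintegral_enorm]
      refine lintegral_mono_ae ?_
      filter_upwards [horth] with z hz
      rw [sub_zero, (hψ k).gradient_smoothAbs_comp, real_inner_smul_right, inner_sub_right, hz, zero_sub,
        enorm_mul, enorm_neg]
      refine mul_le_of_le_one_left zero_le ?_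
      rw [Real.enorm_eq_ofReal_abs]
      exact ENNReal.ofReal_le_one.2 (abs_deriv_smoothAbs_le _)
  have hmeas : AEStronglyMeasurable (fun z => smoothAbs (w z)) (volume.restrict Ω) :=
    contDiff_smoothAbs.continuous.comp_aestronglyMeasurable hwint.1
  -- The masses converge, since `h` is `1`-Lipschitz and `Ω` has finite measure.
  have hmass : Tendsto (fun k => ∫ z in Ω, smoothAbs (ψ k z)) atTop
      (𝓝 (∫ z in Ω, smoothAbs (w z))) := by
    refine tendsto_integral_of_L1 _ hmeas (Eventually.of_forall fun k => (hη k).integrable) ?_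
    have hlim : Tendsto (fun k => eLpNorm (fun z => w z - ψ k z) p (volume.restrict Ω) *
        (volume.restrict Ω) Set.univ ^ (1 / (1 : ℝ≥0∞).toReal - 1 / p.toReal)) atTop (𝓝 0) := by
      have hexp : 0 ≤ 1 / (1 : ℝ≥0∞).toReal - 1 / p.toReal := by
        rcases eq_or_ne p ⊤ with rfl | hpt
        · simp
        · have : 1 ≤ p.toReal := by
            simpa using (ENNReal.toReal_le_toReal ENNReal.one_ne_top hpt).2 hp
          simpa using inv_le_one_of_one_le₀ this
      have h := ENNReal.Tendsto.mul_const hψ0 (Or.inr (ENNReal.rpow_ne_top_of_nonneg hexp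
        (measure_ne_top (volume.restrict Ω) Set.univ)))
      rwa [zero_mul] at h
    refine tendsto_of_tendsto_of_tendsto_of_le_of_le tendsto_const_nhds hlim
      (fun _ => zero_le) fun k => ?_
    refine le_trans ?_ (eLpNorm_le_eLpNorm_mul_rpow_measure_univ hp
      (hwint.1.sub (hψ k).1.continuous.aestronglyMeasurable))
    rw [eLpNorm_one_eq_lintegral_enorm]
    refine lintegral_mono fun z => ?_
    simp only [Real.enorm_eq_ofReal_abs]
    refine ENNReal.ofReal_le_ofReal ?_
    rw [abs_sub_comm (w z)]
    exact abs_smoothAbs_sub_le _ _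
  -- The divergence identity passes to the limit.
  have hzero : ∫ z in Ω, smoothAbs (w z) = 0 := by
    have h1 := (hmass.const_mul c).neg
    have h2 := tendsto_nhds_unique (h1.congr fun k => (hdiv _ (hη k)).symm) hflux
    simpa [hc] using h2
  have hint : Integrable (fun z => smoothAbs (w z)) (volume.restrict Ω) := by
    refine hwint.mono hmeas (Eventually.of_forall fun z => ?_)
    simpa [smoothAbs_zero] using abs_smoothAbs_sub_le (w z) 0
  have hae := (integral_eq_zero_iff_of_nonneg (fun z => smoothAbs_nonneg (w z)) hint).1 hzero
  filter_upwards [hae] with z hz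
  exact eq_zero_of_smoothAbs_eq_zero hz

/-! ### Equality in the convexity of the area -/

/-- The midpoint of two minimizers is a competitor, so the convexity inequality for the norm is an
equality almost everywhere. -/
theorem IsAreaMinimizer.sameRay (hΩ : IsOpen Ω) (hΩb : Bornology.IsBounded Ω) (hp : 1 ≤ p)
    {φ u v : HorizSpace n → ℝ} (hu : MemSobolev Ω p u) (hv : MemSobolev Ω p v)
    (hu_min : IsAreaMinimizer Ω p φ u) (hv_min : IsAreaMinimizer Ω p φ v) :
    ∀ᵐ z ∂volume.restrict Ω, SameRay ℝ (weakGradient Ω u z + (2 : ℝ) • hStar z)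
      (weakGradient Ω v z + (2 : ℝ) • hStar z) := by
  have hfin : IsFiniteMeasure (volume.restrict Ω) := ⟨by simpa using hΩb.measure_lt_top⟩
  have hX : Integrable (fun z : HorizSpace n => (2 : ℝ) • hStar z) (volume.restrict Ω) :=
    ((continuous_hStar.locallyIntegrable.integrableOn_isCompact
      hΩb.isCompact_closure).mono_set subset_closure).smul (2 : ℝ)
  have ha : Integrable (fun z => weakGradient Ω u z + (2 : ℝ) • hStar z) (volume.restrict Ω) :=
    ((hu.memLp_weakGradient hΩ).integrable hp).add hX
  have hb : Integrable (fun z => weakGradient Ω v z + (2 : ℝ) • hStar z) (volume.restrict Ω) :=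
    ((hv.memLp_weakGradient hΩ).integrable hp).add hX
  have hab : Integrable (fun z => (weakGradient Ω u z + (2 : ℝ) • hStar z) +
      (weakGradient Ω v z + (2 : ℝ) • hStar z)) (volume.restrict Ω) := ha.add hb
  have hab' : Integrable (fun z => ‖weakGradient Ω u z + (2 : ℝ) • hStar z‖ +
      ‖weakGradient Ω v z + (2 : ℝ) • hStar z‖) (volume.restrict Ω) := ha.norm.add hb.norm
  have hmid : MemSobolevZero Ω p (fun z => ((1 / 2) * u z + (1 / 2) * v z) - φ z) := by
    convert hu_min.1.linear_comb hΩ hp hv_min.1 (1 / 2) (1 / 2) using 2 with z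
    ring
  have h1 := hu_min.2 _ hmid
  have h2 := hv_min.2 _ hmid
  have hA : areaFunctional Ω (fun z => (1 / 2) * u z + (1 / 2) * v z) = (1 / 2) *
      ∫ z in Ω, ‖(weakGradient Ω u z + (2 : ℝ) • hStar z) +
        (weakGradient Ω v z + (2 : ℝ) • hStar z)‖ := by
    rw [← integral_const_mul]
    refine integral_congr_ae ?_
    filter_upwards [hu.weakGradient_linear_comb hΩ hv (1 / 2) (1 / 2)] with z hz
    rw [hz, show (1 / 2 : ℝ) = ‖(1 / 2 : ℝ)‖ by norm_num, ← norm_smul]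
    congr 1
    norm_num
    module
  have hi : Integrable (fun z => ‖weakGradient Ω u z + (2 : ℝ) • hStar z‖ +
      ‖weakGradient Ω v z + (2 : ℝ) • hStar z‖ - ‖(weakGradient Ω u z + (2 : ℝ) • hStar z) +
        (weakGradient Ω v z + (2 : ℝ) • hStar z)‖) (volume.restrict Ω) :=
    hab'.sub hab.norm
  have hnn : ∀ z, 0 ≤ ‖weakGradient Ω u z + (2 : ℝ) • hStar z‖ +
      ‖weakGradient Ω v z + (2 : ℝ) • hStar z‖ - ‖(weakGradient Ω u z + (2 : ℝ) • hStar z) +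
        (weakGradient Ω v z + (2 : ℝ) • hStar z)‖ := fun z => sub_nonneg.2 (norm_add_le _ _)
  have hz : ∫ z in Ω, (‖weakGradient Ω u z + (2 : ℝ) • hStar z‖ +
      ‖weakGradient Ω v z + (2 : ℝ) • hStar z‖ - ‖(weakGradient Ω u z + (2 : ℝ) • hStar z) +
        (weakGradient Ω v z + (2 : ℝ) • hStar z)‖) = 0 := by
    refine le_antisymm ?_ (integral_nonneg hnn)
    rw [hA] at h1 h2
    unfold areaFunctional at h1 h2
    rw [integral_sub hab' hab.norm, integral_add ha.norm hb.norm]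
    linarith
  filter_upwards [(integral_eq_zero_iff_of_nonneg hnn hi).1 hz] with z hz
  exact sameRay_iff_norm_add.2 (sub_eq_zero.1 hz).symm

/-! ### Uniqueness of minimizers -/

theorem ENNReal.holderConjugate_div_sub_one {p : ℝ≥0∞} (h1 : 1 ≤ p) (ht : p ≠ ⊤) :
    ENNReal.HolderConjugate p (p / (p - 1)) := by
  have h0 : p ≠ 0 := (zero_lt_one.trans_le h1).ne'
  rw [ENNReal.holderConjugate_iff, ENNReal.inv_div (Or.inr ht) (Or.inr h0), ← one_div,
    ENNReal.div_add_div_same, add_tsub_cancel_of_le h1, ENNReal.div_self h0 ht]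

end

theorem proposition5p1 (n : ℕ) (hn : 1 ≤ n) (Ω : Set (HorizSpace n)) (hΩ_open : IsOpen Ω)
    (hΩ_bdd : Bornology.IsBounded Ω) (hΩ_lip : HasLipschitzBoundary Ω)
    (p p' : ℝ≥0∞) (hp_one : 1 ≤ p) (hp_two : p ≤ 2) (hp' : p' = p / (p - 1))
    (φ : HorizSpace n → ℝ) (hφ : MemSobolev Ω p' φ)
    (u v : HorizSpace n → ℝ) (hu : MemSobolev Ω p' u) (hv : MemSobolev Ω p v)
    (hu_min : IsAreaMinimizer Ω p φ u) (hv_min : IsAreaMinimizer Ω p φ v) :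
    ∀ᵐ z ∂(volume.restrict Ω), u z = v z := by
  have hpt : p ≠ ⊤ := (hp_two.trans_lt (by simp)).ne
  have hpp' : ENNReal.HolderConjugate p p' := hp' ▸ ENNReal.holderConjugate_div_sub_one hp_one hpt
  have hp'p : ENNReal.HolderConjugate p' p := ENNReal.HolderTriple.symm
  -- Since `p ≤ 2`, `u` belongs to `W^{1,p}` as well.
  have hle : p ≤ p' := by
    rw [hp', ENNReal.le_div_iff_mul_le (Or.inr (zero_lt_one.trans_le hp_one).ne') (Or.inr hpt)]
    refine mul_le_of_le_one_right zero_le ?_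
    rw [tsub_le_iff_right]
    exact hp_two.trans_eq one_add_one_eq_two.symm
  have hu_p : MemSobolev Ω p u := hu.mono_exponent hΩ_bdd hle
  have hray := hu_min.sameRay hΩ_open hΩ_bdd hp_one hu_p hv hv_min
  have hw : MemSobolevZero Ω p (fun z => 1 * u z + -1 * v z) := by
    convert hu_min.1.linear_comb hΩ_open hp_one hv_min.1 1 (-1) using 2 with z
    ring
  have hG := hu.memLp_weakGradient hΩ_open
  have hfin : IsFiniteMeasure (volume.restrict Ω) := ⟨by simpa using hΩ_bdd.measure_lt_top⟩
  -- This is where the higher integrability of `∇u` enters.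
  have hF : MemLp (fun z => (2 : ℝ) • z - hStar (weakGradient Ω u z)) p' (volume.restrict Ω) := by
    obtain ⟨C, hC⟩ := hΩ_bdd.exists_norm_le
    have h1 : MemLp (fun z : HorizSpace n => z) p' (volume.restrict Ω) :=
      MemLp.of_bound aestronglyMeasurable_id C
        ((ae_restrict_iff' hΩ_open.measurableSet).2 (Eventually.of_forall hC))
    refine (h1.const_smul (2 : ℝ)).sub (hG.of_le
      (continuous_hStar.comp_aestronglyMeasurable hG.1) (Eventually.of_forall fun z => ?_))
    exact (norm_hStar _).le
  have hn0 : (4 * n : ℝ) ≠ 0 := by positivity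
  have key := hw.ae_eq_zero_of_inner_eq_zero hΩ_open hΩ_bdd hF hn0
    (fun η hη => hu.hasWeakGradient.setIntegral_inner_eq hη) ?_
  · filter_upwards [key] with z hz
    linarith
  · filter_upwards [hray, hu_p.weakGradient_linear_comb hΩ_open hv 1 (-1)] with z hz hwz
    rw [hwz, one_smul, neg_one_smul, ← sub_eq_add_neg]
    exact inner_sub_eq_zero_of_sameRay hz
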